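/- Let $((x))$ denote the sawtooth function, $((x))=x-\lfloor x\rfloor-\tfrac12$ for $x\in\mathbb R\setminus\mathbb Z$ and $((x))=0$ for $x\in\mathbb Z$. For an integer $d\ge 1$ and integers $b,c$ coprime to $d$ define the Dedekind sum and the Dedekind–Rademacher sum by $$s(c,d)=\sum_{a=1}^{d-1}\left(\left(\frac{a}{d}\right)\right)\left(\left(\frac{ac}{d}\right)\right),\qquad s(b,c,d)=\sum_{a=1}^{d-1}\left(\left(\frac{ab}{d}\right)\right)\left(\left(\frac{ac}{d}\right)\right).$$ Let $\phi$ be Euler's totient function. **Theorem.** (1) There is an absolute constant $C>0$ such that for every prime $p$ and every integer $h$ whose class in $(\mathbb Z/p\mathbb Z)^*$ has odd multiplicative order $k\ge 3$, $$|s(h,p)|\le C\,(\log p)^2\,p^{1-\frac1{\phi(k)}}.$$ (2) For all natural numbers $q_1,q_2$ there is a constant $C>0$, depending only on $q_1,q_2$, such that for every prime $p$ dividing neither $q_1$ nor $q_2$ and every integer $h$ whose class in $(\mathbb Z/p\mathbb Z)^*$ has multiplicative order $k\ge 3$ (odd or even), $$|s(q_1,q_2h,p)|\le C\,(\log p)^2\,p^{1-\frac1{\phi(k)}}.$$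 -/

import Mathlib

open Classical in
/-- The sawtooth function `((x))`: it is `x - ⌊x⌋ - 1/2` off the integers and `0` at integers. -/
noncomputable def sawtooth (x : ℝ) : ℝ :=
  if ∃ n : ℤ, (n : ℝ) = x then 0 else x - (⌊x⌋ : ℝ) - 1 / 2

/-- The Dedekind sum `s(c, d) = ∑_{a=1}^{d-1} ((a/d)) ((ac/d))`
(used for `d ≥ 1` and `gcd(c, d) = 1`). -/
noncomputable def dedekindSum (c : ℤ) (d : ℕ) : ℝ :=
  ∑ a ∈ Finset.Ico 1 d, sawtooth ((a : ℝ) / (d : ℝ)) * sawtooth ((a : ℝ) * (c : ℝ) / (d : ℝ))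

/-- The Dedekind–Rademacher sum `s(b, c, d) = ∑_{a=1}^{d-1} ((ab/d)) ((ac/d))`
(used for `d ≥ 1` and `gcd(b, d) = gcd(c, d) = 1`). -/
noncomputable def dedekindRademacherSum (b c : ℤ) (d : ℕ) : ℝ :=
  ∑ a ∈ Finset.Ico 1 d,
    sawtooth ((a : ℝ) * (b : ℝ) / (d : ℝ)) * sawtooth ((a : ℝ) * (c : ℝ) / (d : ℝ))

/-! Substituting in the sum over residues turns `s(q₁, q₂h, p)` into an ordinary Dedekind sum `s(c,
p)` with `c = q₁⁻¹ q₂ h` mod `p`. Reciprocity along the Euclidean algorithm for `(c, p)` bounds it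
by the number of steps, `O(log p)`, times the largest partial quotient (`abs_natDedekindSum_le`). A
large quotient would force a short vector in the lattice `y ≡ c x (mod p)`. Short vectors do not
exist (`le_abs_add_abs_pow_totient`): the homogenized cyclotomic form of degree `φ(k)` is divisible
by `p` at `(X, Y)` when `Y ≡ h X`, and it has no nontrivial real zero for `k ≥ 3`, so some
coordinate is `≫ p^(1/φ(k))`. This works for either parity of `k`; part (1) is the case `q₁ = q₂ =
1`. -/

open Finset

/-! ### Dedekind sums of natural numbers and reciprocity -/

/-- The Dedekind sum of natural numbers `h`, `k`, written with remainders. -/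
noncomputable def natDedekindSum (h k : ℕ) : ℝ :=
  ∑ j ∈ range k, ((j : ℝ) / k - 1 / 2) * (((h * j % k : ℕ) : ℝ) / k - 1 / 2) - 1 / 4

theorem natDedekindSum_mod (h k : ℕ) : natDedekindSum (h % k) k = natDedekindSum h k := by
  simp [natDedekindSum, Nat.mul_mod]

theorem natDedekindSum_zero_one : natDedekindSum 0 1 = 0 := by
  norm_num [natDedekindSum]

theorem sum_range_comp_mul_mod {M : Type*} [AddCommMonoid M] {h k : ℕ} (hc : h.Coprime k)
    (f : ℕ → M) : ∑ j ∈ range k, f (h * j % k) = ∑ j ∈ range k, f j := by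
  rcases Nat.eq_zero_or_pos k with rfl | hk
  · simp
  have hmaps : Set.MapsTo (fun j => h * j % k) (range k : Finset ℕ) (range k : Finset ℕ) := by
    intro j _
    simpa using Nat.mod_lt _ hk
  have hinj : Set.InjOn (fun j => h * j % k) (range k : Finset ℕ) := by
    intro a ha b hb hab
    have h1 : a ≡ b [MOD k] := Nat.ModEq.cancel_left_of_coprime hc.symm hab
    simp only [coe_range, Set.mem_Iio] at ha hb
    exact Nat.ModEq.eq_of_lt_of_lt h1 ha hb
  refine sum_bij (fun j _ => h * j % k) (fun j hj => hmaps hj) (fun a ha b hb hab => hinj ha hb hab)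
    ?_ (fun _ _ => rfl)
  intro b hb
  obtain ⟨a, ha, hab⟩ := Finset.surjOn_of_injOn_of_card_le _ hmaps hinj le_rfl hb
  exact ⟨a, ha, hab⟩

theorem sum_range_cast_real (n : ℕ) : ∑ j ∈ range n, (j : ℝ) = n * (n - 1) / 2 := by
  induction n with
  | zero => simp
  | succ n ih => rw [sum_range_succ, ih]; push_cast; ring

theorem sum_range_sq_cast_real (n : ℕ) :
    ∑ j ∈ range n, (j : ℝ) ^ 2 = n * (n - 1) * (2 * n - 1) / 6 := by
  induction n with
  | zero => simp
  | succ n ih => rw [sum_range_succ, ih]; push_cast; ring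

theorem cast_mod_eq (a k : ℕ) : ((a % k : ℕ) : ℝ) = a - k * ((a / k : ℕ) : ℝ) := by
  have := Nat.mod_add_div a k
  have h2 : ((a % k : ℕ) : ℝ) + k * ((a / k : ℕ) : ℝ) = a := by exact_mod_cast this
  linarith

/-- The linear moment of the floors `⌊h j / k⌋`. -/
theorem sum_floor {h k : ℕ} (hk : 0 < k) (hc : h.Coprime k) :
    ∑ j ∈ range k, ((h * j / k : ℕ) : ℝ) = (h - 1) * (k - 1) / 2 := by
  have h1 := sum_range_comp_mul_mod hc (fun j => (j : ℝ))
  simp only [cast_mod_eq, sum_sub_distrib, ← mul_sum, Nat.cast_mul, sum_range_cast_real] at h1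
  have hk' : (k : ℝ) ≠ 0 := by positivity
  apply mul_left_cancel₀ hk'
  linarith

/-- Multiplication by `h` permutes residues, so squares of remainders have a known sum; expanding
`(h j - k ⌊h j / k⌋)²` ties the mixed moment to the square moment. -/
theorem sum_floor_sq {h k : ℕ} (hc : h.Coprime k) :
    (h : ℝ) ^ 2 * (k * (k - 1) * (2 * k - 1) / 6)
      - 2 * h * k * ∑ j ∈ range k, (j : ℝ) * ((h * j / k : ℕ) : ℝ)
      + (k : ℝ) ^ 2 * ∑ j ∈ range k, ((h * j / k : ℕ) : ℝ) ^ 2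
      = k * (k - 1) * (2 * k - 1) / 6 := by
  have h1 := sum_range_comp_mul_mod hc (fun j => (j : ℝ) ^ 2)
  rw [← sum_range_sq_cast_real]
  refine Eq.trans ?_ h1
  rw [mul_sum, mul_sum, mul_sum, ← sum_sub_distrib,
    ← sum_add_distrib]
  refine sum_congr rfl fun j _ => ?_
  rw [cast_mod_eq]
  push_cast
  ring

theorem natDedekindSum_eq {h k : ℕ} (hk : 0 < k) (hc : h.Coprime k) :
    natDedekindSum h k = h * (k - 1) * (2 * k - 1) / (6 * k)
      - (∑ j ∈ range k, (j : ℝ) * ((h * j / k : ℕ) : ℝ)) / k - (k - 1) / 4 := by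
  have hk' : (k : ℝ) ≠ 0 := by positivity
  have e : ∀ j ∈ range k, ((j : ℝ) / k - 1 / 2) * (((h * j % k : ℕ) : ℝ) / k - 1 / 2)
      = h / (k : ℝ) ^ 2 * (j : ℝ) ^ 2 - 1 / k * ((j : ℝ) * ((h * j / k : ℕ) : ℝ))
        - (1 + h) / (2 * k) * j + 1 / 2 * ((h * j / k : ℕ) : ℝ) + 1 / 4 := by
    intro j _
    rw [cast_mod_eq]
    push_cast
    field_simp
    ring
  rw [natDedekindSum, sum_congr rfl e]
  simp only [sum_sub_distrib, sum_add_distrib, ← mul_sum, sum_floor hk hc, sum_range_cast_real,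
    sum_range_sq_cast_real, sum_const, card_range, nsmul_eq_mul]
  field_simp
  ring

/-- Double counting of lattice points: square of floor as a sum over the dual index. -/
theorem sum_floor_sq_dual {h k : ℕ} (hh : 0 < h) (hk : 0 < k) (hc : h.Coprime k) :
    ∑ j ∈ range k, ((h * j / k : ℕ) : ℝ) ^ 2
      = ∑ i ∈ Ico 1 h, (2 * (i : ℝ) - 1) * (k - 1 - ((k * i / h : ℕ) : ℝ)) := by
  -- A square is a sum of consecutive odd numbers, which makes the order of summation exchangeable.
  have hsq : ∀ n : ℕ, (n : ℝ) ^ 2 = ∑ i ∈ Ico 1 (n + 1), (2 * (i : ℝ) - 1) := by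
    intro n
    induction n with
    | zero => simp
    | succ n ih => rw [sum_Ico_succ_top (by omega), ← ih]; push_cast; ring
  have hl : ∀ j ∈ range k, ((h * j / k : ℕ) : ℝ) ^ 2
      = ∑ i ∈ Ico 1 h, if i * k ≤ h * j then 2 * (i : ℝ) - 1 else 0 := by
    intro j hj
    rw [hsq, ← sum_filter]
    refine sum_congr ?_ fun _ _ => rfl
    ext i
    simp only [mem_Ico, mem_filter, mem_range, Nat.lt_succ_iff, Nat.le_div_iff_mul_le hk] at hj ⊢
    constructor
    · rintro ⟨h1, h2⟩
      refine ⟨⟨h1, ?_⟩, h2⟩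
      by_contra! hcon
      nlinarith
    · rintro ⟨⟨h1, _⟩, h2⟩
      exact ⟨h1, h2⟩
  rw [sum_congr rfl hl, sum_comm]
  refine sum_congr rfl fun i hi => ?_
  rw [mem_Ico] at hi
  rw [← sum_filter, sum_const, nsmul_eq_mul, mul_comm]
  congr 1
  have hlt : k * i / h < k := by
    rw [Nat.div_lt_iff_lt_mul hh]
    nlinarith
  -- Equality `k i = h j` is impossible: `h` would divide `i`, but `1 ≤ i < h`.
  have hset : (range k).filter (fun j => i * k ≤ h * j) = Ico (k * i / h + 1) k := by
    ext j
    simp only [mem_filter, mem_range, mem_Ico, Nat.succ_le_iff, Nat.div_lt_iff_lt_mul hh]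
    constructor
    · rintro ⟨h1, h2⟩
      refine ⟨lt_of_le_of_ne (by linarith) fun he => ?_, h1⟩
      have hd : h ∣ k * i := ⟨j, by linarith⟩
      have := Nat.le_of_dvd (by omega) (hc.dvd_of_dvd_mul_left hd)
      omega
    · rintro ⟨h1, h2⟩
      exact ⟨h2, by linarith⟩
  rw [hset, Nat.card_Ico, Nat.cast_sub hlt]
  push_cast
  ring

/-- Dedekind's reciprocity law. -/
theorem natDedekindSum_reciprocity {h k : ℕ} (hh : 0 < h) (hk : 0 < k) (hc : h.Coprime k) :
    natDedekindSum h k + natDedekindSum k h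
      = -1 / 4 + ((h : ℝ) / k + k / h + 1 / (h * k)) / 12 := by
  have hk' : (k : ℝ) ≠ 0 := by positivity
  have hh' : (h : ℝ) ≠ 0 := by positivity
  rw [natDedekindSum_eq hk hc, natDedekindSum_eq hh hc.symm]
  have hA := sum_floor_sq hc
  have hB := sum_floor_sq_dual hh hk hc
  -- The term `i = 0` equals `-(k - 1)`.
  have h0 : ∑ i ∈ Ico 1 h, (2 * (i : ℝ) - 1) * (k - 1 - ((k * i / h : ℕ) : ℝ))
      = ∑ i ∈ range h, (2 * (i : ℝ) - 1) * (k - 1 - ((k * i / h : ℕ) : ℝ)) + (k - 1) := by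
    rw [range_eq_Ico, sum_eq_sum_Ico_succ_bot hh]
    simp
    ring
  have e : ∀ i ∈ range h, (2 * (i : ℝ) - 1) * (k - 1 - ((k * i / h : ℕ) : ℝ))
      = 2 * (k - 1) * (i : ℝ) - (k - 1) - 2 * (i * ((k * i / h : ℕ) : ℝ))
        + ((k * i / h : ℕ) : ℝ) := by
    intro i _; ring
  rw [h0, sum_congr rfl e] at hB
  simp only [sum_sub_distrib, sum_add_distrib, ← mul_sum, sum_floor hh hc.symm,
    sum_range_cast_real, sum_const, card_range, nsmul_eq_mul] at hB
  rw [hB] at hA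
  generalize ∑ j ∈ range k, (j : ℝ) * ((h * j / k : ℕ) : ℝ) = F at hA ⊢
  generalize ∑ j ∈ range h, (j : ℝ) * ((k * j / h : ℕ) : ℝ) = G at hA ⊢
  field_simp
  apply mul_left_cancel₀ hk'
  linear_combination 144 * hA

/-! ### Reciprocity along the Euclidean algorithm -/

/-- Bound for a Dedekind sum along the Euclidean algorithm: if every nonzero vector of the lattice
`y ≡ c x (mod p)` has a coordinate of size at least `M`, all partial quotients are at most
`p / M`. -/
theorem abs_natDedekindSum_le {p : ℕ} {c : ZMod p} {M : ℝ} (hM : 0 < M)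
    (hlat : ∀ x y : ℤ, (y : ZMod p) = c * x → 0 < x → y ≠ 0 → M ≤ max (x : ℝ) |(y : ℝ)|)
    (r : ℕ) : ∀ r' q q' : ℕ, ∀ ε : ℤ, 0 < r → r ≤ r' → 0 < q → r.Coprime r' →
      (ε = 1 ∨ ε = -1) → q * r' + q' * r = p →
      (r : ZMod p) = ε * c * q → (r' : ZMod p) = -(ε * c * q') →
      |natDedekindSum r r'| ≤ (1 + p / M) * (1 + Real.logb 2 (r * r')) := by
  induction r using Nat.strong_induction_on with
  | _ r ih =>
  intro r' q q' ε hr hrr hq hc hε hsum h1 h2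
  have hr' : 0 < r' := by omega
  have hrR : (1 : ℝ) ≤ r := by exact_mod_cast hr
  have hrrR : (r : ℝ) ≤ r' := by exact_mod_cast hrr
  have hqR : (1 : ℝ) ≤ q := by exact_mod_cast hq
  -- The vector `(q, ε r)` lies in the lattice, so `M ≤ max q r ≤ q r`, while the invariant gives `q
  -- r' ≤ p`.
  have hquot : (r' : ℝ) / r ≤ p / M := by
    have hmax : M ≤ max (q : ℝ) r := by
      have h3 := hlat q (ε * r) (by
        push_cast
        rw [h1]
        rcases hε with rfl | rfl <;> push_cast <;> ring) (by exact_mod_cast hq)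
        (by rcases hε with rfl | rfl <;> simp <;> omega)
      rcases hε with rfl | rfl <;> simpa using h3
    have hMqr : M ≤ q * r := by
      refine hmax.trans (max_le ?_ ?_) <;> nlinarith
    have hqp : (q : ℝ) * r' ≤ p := by
      have : q * r' ≤ p := by rw [← hsum]; exact Nat.le_add_right _ _
      exact_mod_cast this
    rw [div_le_div_iff₀ (by linarith) hM]
    calc (r' : ℝ) * M ≤ r' * (q * r) := by gcongr
      _ = (q * r') * r := by ring
      _ ≤ p * r := by gcongr
  have hrec := natDedekindSum_reciprocity hr hr' hc
  rw [← natDedekindSum_mod r' r] at hrec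
  have hstep : |natDedekindSum r r'| ≤ |natDedekindSum (r' % r) r| + (1 + p / M) := by
    have e1 : (r : ℝ) / r' ≤ 1 := by rw [div_le_one (by linarith)]; exact hrrR
    have e2 : 1 / ((r : ℝ) * r') ≤ 1 := by
      rw [div_le_one (by nlinarith)]; nlinarith
    have e3 : 0 ≤ (r : ℝ) / r' := by positivity
    have e4 : 0 ≤ (r' : ℝ) / r := by positivity
    have e5 : 0 ≤ 1 / ((r : ℝ) * r') := by positivity
    have e6 : natDedekindSum r r' = -natDedekindSum (r' % r) r
      + (-1 / 4 + ((r : ℝ) / r' + r' / r + 1 / (r * r')) / 12) := by linarith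
    rw [e6]
    refine (abs_add_le _ _).trans ?_
    rw [abs_neg]
    gcongr
    rw [abs_le]
    constructor <;> linarith
  have hB : 0 ≤ 1 + p / M := by positivity
  rcases Nat.eq_zero_or_pos (r' % r) with h0 | hpos
  · have hr1 : r = 1 := Nat.eq_one_of_dvd_coprimes hc dvd_rfl (Nat.dvd_of_mod_eq_zero h0)
    rw [h0, hr1, natDedekindSum_zero_one, abs_zero, zero_add] at hstep
    rw [← hr1] at hstep
    refine hstep.trans (le_mul_of_one_le_right hB ?_)
    have : 0 ≤ Real.logb 2 ((r : ℝ) * r') :=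
      Real.logb_nonneg one_lt_two (by nlinarith)
    linarith
  · have hlt := Nat.mod_lt r' hr
    have hdm := Nat.mod_add_div r' r
    have hdpos : 0 < r' / r := Nat.div_pos hrr hr
    -- The cofactors follow the continuant recursion and the sign alternates.
    have key := ih (r' % r) hlt r (q * (r' / r) + q') q (-ε) hpos hlt.le (by positivity)
      (by
        have : (r' % r).gcd r = 1 := by rw [← Nat.gcd_rec]; exact hc
        exact this)
      (by rcases hε with rfl | rfl <;> simp)
      (by
        rw [← hsum]
        nth_rw 3 [← hdm]
        ring)
      (by
        have h3 : ((r' % r : ℕ) : ZMod p) = r' - r * ((r' / r : ℕ) : ZMod p) := by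
          have : ((r' % r + r * (r' / r) : ℕ) : ZMod p) = r' := by rw [hdm]
          push_cast at this
          rw [← this]; ring
        rw [h3, h1, h2]; push_cast; ring)
      (by rw [h1]; simp)
    -- Each division at least halves the product of the two remainders, so the drop in the logarithm
    -- pays for one step.
    have hlog : Real.logb 2 (((r' % r : ℕ) : ℝ) * r) + 1 ≤ Real.logb 2 ((r : ℝ) * r') := by
      have hmp : (0 : ℝ) < ((r' % r : ℕ) : ℝ) := by exact_mod_cast hpos
      rw [← Real.logb_self_eq_one (b := 2) one_lt_two, ← Real.logb_mul (by positivity) (by norm_num)]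
      apply Real.logb_le_logb_of_le one_lt_two (by positivity)
      have : 2 * (r' % r) ≤ r' := by nlinarith
      have h4 : 2 * ((r' % r : ℕ) : ℝ) ≤ r' := by exact_mod_cast this
      nlinarith
    nlinarith [mul_le_mul_of_nonneg_left hlog hB]

/-! ### Cyclotomic lower bound for lattice vectors -/

/-- A lower bound for the nonzero vectors of the lattice `Y ≡ h X (mod p)`, for a root of unity
`h` of order `k` modulo `p`. -/
theorem le_abs_add_abs_pow_totient {p k : ℕ} (hk : 3 ≤ k) [Fact p.Prime] {z : ZMod p}
    (hz : IsPrimitiveRoot z k) {X Y : ℤ} (hX : X ≠ 0) (hXY : (Y : ZMod p) = z * X) :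
    (p : ℝ) ≤ (|(X : ℝ)| + |(Y : ℝ)|) ^ k.totient := by
  set N : ℤ := ((Polynomial.cyclotomic k ℤ).scaleRoots X).eval Y with hN
  have hXR : (X : ℝ) ≠ 0 := by exact_mod_cast hX
  have hdeg := Polynomial.natDegree_cyclotomic k ℤ
  have hreal : (N : ℝ) = (X : ℝ) ^ k.totient
      * (Polynomial.cyclotomic k ℝ).eval ((Y : ℝ) / X) := by
    have h1 := Polynomial.scaleRoots_eval₂_mul (p := Polynomial.cyclotomic k ℤ)
      (Int.castRingHom ℝ) ((Y : ℝ) / X) X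
    rw [hdeg, eq_intCast, mul_div_cancel₀ _ hXR,
      Polynomial.eval₂_eq_eval_map (p := Polynomial.cyclotomic k ℤ), Polynomial.map_cyclotomic] at h1
    rw [← h1, hN]
    exact (Polynomial.eval₂_at_intCast (Int.castRingHom ℝ) Y).symm
  have hmod : (N : ZMod p) = 0 := by
    have h1 := Polynomial.scaleRoots_eval₂_mul (p := Polynomial.cyclotomic k ℤ)
      (Int.castRingHom (ZMod p)) z X
    have hroot : (Polynomial.cyclotomic k (ZMod p)).eval z = 0 :=
      hz.isRoot_cyclotomic (by omega)
    rw [Polynomial.eval₂_eq_eval_map (p := Polynomial.cyclotomic k ℤ),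
      Polynomial.map_cyclotomic, hroot, mul_zero, eq_intCast, mul_comm, ← hXY] at h1
    rw [← h1, hN]
    exact (Polynomial.eval₂_at_intCast (Int.castRingHom (ZMod p)) Y).symm
  -- Here `k ≥ 3` enters: `Φ_k` is positive on the real line.
  have hne : N ≠ 0 := by
    intro h0
    rw [h0, Int.cast_zero] at hreal
    have := Polynomial.cyclotomic_pos (n := k) (by omega) ((Y : ℝ) / X)
    exact mul_ne_zero (pow_ne_zero _ hXR) this.ne' hreal.symm
  have hdvd : (p : ℤ) ∣ N := (ZMod.intCast_zmod_eq_zero_iff_dvd N p).mp hmod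
  have hpN : (p : ℝ) ≤ |(N : ℝ)| := by
    have := Int.le_of_dvd (abs_pos.mpr hne) ((dvd_abs _ _).mpr hdvd)
    exact_mod_cast this
  -- All roots lie on the unit circle, so each linear factor is at most `1 + |t|`.
  have hcyc : ∀ t : ℝ, |(Polynomial.cyclotomic k ℝ).eval t| ≤ (1 + |t|) ^ k.totient := by
    intro t
    have h1 : (((Polynomial.cyclotomic k ℝ).eval t : ℝ) : ℂ)
        = (Polynomial.cyclotomic k ℂ).eval (t : ℂ) := by
      rw [← Polynomial.map_cyclotomic k (algebraMap ℝ ℂ), Polynomial.eval_map]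
      exact (Polynomial.eval₂_at_apply (algebraMap ℝ ℂ) t).symm
    have hprim := Complex.isPrimitiveRoot_exp k (by omega)
    rw [← Real.norm_eq_abs, ← Complex.norm_real, h1, Polynomial.cyclotomic_eq_prod_X_sub_primitiveRoots hprim,
      Polynomial.eval_prod, norm_prod, ← hprim.card_primitiveRoots, ← prod_const]
    refine prod_le_prod (fun _ _ => norm_nonneg _) fun ζ hζ => ?_
    have hn : ‖ζ‖ = 1 :=
      ((mem_primitiveRoots (by omega)).mp hζ).norm'_eq_one (by omega)
    simp only [Polynomial.eval_sub, Polynomial.eval_X, Polynomial.eval_C]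
    calc ‖(t : ℂ) - ζ‖ ≤ ‖(t : ℂ)‖ + ‖ζ‖ := norm_sub_le _ _
      _ = 1 + |t| := by rw [hn, Complex.norm_real, Real.norm_eq_abs, add_comm]
  calc (p : ℝ) ≤ |(N : ℝ)| := hpN
    _ = |(X : ℝ)| ^ k.totient * |(Polynomial.cyclotomic k ℝ).eval ((Y : ℝ) / X)| := by
      rw [hreal, abs_mul, abs_pow]
    _ ≤ |(X : ℝ)| ^ k.totient * (1 + |(Y : ℝ) / X|) ^ k.totient := by gcongr; exact hcyc _
    _ = (|(X : ℝ)| + |(Y : ℝ)|) ^ k.totient := by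
      rw [← mul_pow, abs_div]
      congr 1
      have := abs_pos.mpr hXR
      field_simp

/-! ### From sawtooth sums to residues modulo `p` -/

/-- The sawtooth function `((z / p))` on residue classes modulo `p`. -/
noncomputable def zmodSawtooth {p : ℕ} (z : ZMod p) : ℝ :=
  if z = 0 then 0 else (z.val : ℝ) / p - 1 / 2

theorem sawtooth_intCast_div {p : ℕ} [NeZero p] (m : ℤ) :
    sawtooth ((m : ℝ) / p) = zmodSawtooth (m : ZMod p) := by
  have hp : (p : ℝ) ≠ 0 := by exact_mod_cast NeZero.ne p
  have hiff : (∃ n : ℤ, (n : ℝ) = (m : ℝ) / p) ↔ (m : ZMod p) = 0 := by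
    rw [ZMod.intCast_zmod_eq_zero_iff_dvd]
    constructor
    · rintro ⟨n, hn⟩
      refine ⟨n, ?_⟩
      rw [eq_div_iff hp] at hn
      have : n * (p : ℤ) = m := by exact_mod_cast hn
      rw [← this, mul_comm]
    · rintro ⟨n, rfl⟩
      refine ⟨n, ?_⟩
      push_cast
      field_simp
  rw [sawtooth, zmodSawtooth]
  simp only [hiff]
  split_ifs
  · rfl
  · congr 1
    have h1 : (((m : ZMod p).val : ℤ) : ℝ) = ((m % (p : ℤ) : ℤ) : ℝ) := by rw [ZMod.val_intCast]
    have h2 := Int.fract_div_intCast_eq_div_intCast_mod (k := ℝ) (m := m) (n := p)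
    rw [Int.cast_natCast] at h1
    rw [h1, ← h2, Int.self_sub_floor]

theorem sum_zmod_eq_sum_range {p : ℕ} [NeZero p] (f : ZMod p → ℝ) :
    ∑ z : ZMod p, f z = ∑ j ∈ range p, f (j : ZMod p) := by
  symm
  refine sum_bij (fun j _ => (j : ZMod p)) (fun _ _ => mem_univ _) ?_ ?_ (fun _ _ => rfl)
  · intro a ha b hb hab
    rw [mem_range] at ha hb
    have := congrArg ZMod.val hab
    rwa [ZMod.val_cast_of_lt ha, ZMod.val_cast_of_lt hb] at this
  · intro z _
    exact ⟨z.val, mem_range.mpr z.val_lt, ZMod.natCast_zmod_val z⟩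

theorem dedekindRademacherSum_eq_sum_zmod {p : ℕ} [NeZero p] (b c : ℤ) :
    dedekindRademacherSum b c p
      = ∑ z : ZMod p, zmodSawtooth (z * (b : ZMod p)) * zmodSawtooth (z * (c : ZMod p)) := by
  rw [sum_zmod_eq_sum_range, range_eq_Ico, sum_eq_sum_Ico_succ_bot (NeZero.pos p),
    dedekindRademacherSum]
  simp only [Nat.cast_zero, zero_mul]
  rw [show zmodSawtooth (0 : ZMod p) = 0 by simp [zmodSawtooth], zero_mul, zero_add]
  refine sum_congr rfl fun a _ => ?_
  have h1 := sawtooth_intCast_div (p := p) ((a : ℤ) * b)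
  have h2 := sawtooth_intCast_div (p := p) ((a : ℤ) * c)
  push_cast at h1 h2
  rw [h1, h2]

theorem natDedekindSum_eq_sum_zmod {p : ℕ} [Fact p.Prime] {c : ZMod p} (hc : c ≠ 0) :
    natDedekindSum c.val p = ∑ z : ZMod p, zmodSawtooth z * zmodSawtooth (z * c) := by
  have hp : 0 < p := (Fact.out : p.Prime).pos
  rw [sum_zmod_eq_sum_range, range_eq_Ico, sum_eq_sum_Ico_succ_bot hp, natDedekindSum,
    range_eq_Ico, sum_eq_sum_Ico_succ_bot hp]
  have h0 : zmodSawtooth ((0 : ℕ) : ZMod p) = 0 := by simp [zmodSawtooth]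
  have hs : ∀ j ∈ Ico (0 + 1) p,
      ((j : ℝ) / p - 1 / 2) * (((c.val * j % p : ℕ) : ℝ) / p - 1 / 2)
        = zmodSawtooth (j : ZMod p) * zmodSawtooth ((j : ZMod p) * c) := by
    intro j hj
    rw [mem_Ico] at hj
    have hj0 : (j : ZMod p) ≠ 0 := by
      rw [Ne, ZMod.natCast_eq_zero_iff]
      exact Nat.not_dvd_of_pos_of_lt (by omega) hj.2
    rw [zmodSawtooth, zmodSawtooth, if_neg hj0, if_neg (mul_ne_zero hj0 hc), ZMod.val_mul,
      ZMod.val_cast_of_lt hj.2, mul_comm j]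
  rw [sum_congr rfl hs, h0]
  norm_num

theorem dedekindRademacherSum_eq_natDedekindSum {p : ℕ} [Fact p.Prime] {b c : ℤ}
    (hb : (b : ZMod p) ≠ 0) (hc : (c : ZMod p) ≠ 0) :
    dedekindRademacherSum b c p = natDedekindSum ((b : ZMod p)⁻¹ * c).val p := by
  rw [dedekindRademacherSum_eq_sum_zmod,
    natDedekindSum_eq_sum_zmod (mul_ne_zero (inv_ne_zero hb) hc)]
  refine Fintype.sum_equiv (Equiv.mulRight₀ (b : ZMod p) hb) _ _ fun z => ?_
  simp only [Equiv.mulRight₀_apply]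
  congr 2
  field_simp

theorem dedekindSum_eq_dedekindRademacherSum (h : ℤ) (d : ℕ) :
    dedekindSum h d = dedekindRademacherSum ((1 : ℕ) : ℤ) (((1 : ℕ) : ℤ) * h) d := by
  simp [dedekindSum, dedekindRademacherSum]

/-! ### The explicit bound and the theorem -/

theorem abs_dedekindRademacherSum_le (q₁ q₂ p k : ℕ) (h : ℤ) (u : (ZMod p)ˣ) (hp : p.Prime)
    (hq₁ : Nat.Coprime q₁ p) (hq₂ : Nat.Coprime q₂ p) (hu : (u : ZMod p) = (h : ZMod p))
    (hord : orderOf u = k) (hk : 3 ≤ k) :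
    |dedekindRademacherSum (q₁ : ℤ) ((q₂ : ℤ) * h) p| ≤
      5 * (1 + (q₁ + q₂)) * (Real.log (p : ℝ)) ^ 2
        * (p : ℝ) ^ (1 - 1 / (Nat.totient k : ℝ)) := by
  have : Fact p.Prime := ⟨hp⟩
  have hne : ∀ q : ℕ, Nat.Coprime q p → (q : ZMod p) ≠ 0 := by
    intro q hq
    rw [Ne, ZMod.natCast_eq_zero_iff]
    exact (Nat.Prime.coprime_iff_not_dvd hp).mp hq.symm
  have hq₁0 := hne q₁ hq₁
  have hq₂0 := hne q₂ hq₂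
  have hpos : ∀ q : ℕ, (q : ZMod p) ≠ 0 → 0 < q := by
    rintro q hq
    exact Nat.pos_of_ne_zero fun h0 => hq (by simp [h0])
  have hq₁p := hpos q₁ hq₁0
  have hq₂p := hpos q₂ hq₂0
  have hz : IsPrimitiveRoot (h : ZMod p) k := by
    rw [← hu, ← hord]
    exact (IsPrimitiveRoot.coe_units_iff).mpr (IsPrimitiveRoot.orderOf u)
  have hh0 : (h : ZMod p) ≠ 0 := by rw [← hu]; exact u.ne_zero
  -- Since `k` divides `p - 1`, `p` exceeds `e`, whence `log p ≥ 1` below.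
  have hpk : 3 < p := by
    have h1 : k ∣ p - 1 := by rw [← hord]; exact ZMod.orderOf_units_dvd_card_sub_one u
    have := Nat.le_of_dvd (by have := hp.two_le; omega) h1
    omega
  have hpR : (3 : ℝ) < p := by exact_mod_cast hpk
  have hφ2 : 2 ≤ k.totient := by
    have h1 := Nat.totient_even (n := k) (by omega)
    have h2 := Nat.totient_pos.mpr (show 0 < k by omega)
    obtain ⟨m, hm⟩ := h1
    omega
  have hφ : (2 : ℝ) ≤ k.totient := by exact_mod_cast hφ2
  have hφinv : 1 / (k.totient : ℝ) ≤ 1 := by rw [div_le_one (by linarith)]; linarith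
  set P : ℝ := (p : ℝ) ^ (1 / (k.totient : ℝ)) with hP
  have hPpos : 0 < P := by positivity
  have hQ : (0 : ℝ) < q₁ + q₂ := by positivity
  set c : ZMod p := ((q₁ : ℤ) : ZMod p)⁻¹ * (((q₂ : ℤ) * h : ℤ) : ZMod p) with hcdef
  have hb0 : ((q₁ : ℤ) : ZMod p) ≠ 0 := by simpa using hq₁0
  have hc0' : (((q₂ : ℤ) * h : ℤ) : ZMod p) ≠ 0 := by
    push_cast; exact mul_ne_zero hq₂0 hh0
  have hc0 : c ≠ 0 := mul_ne_zero (inv_ne_zero hb0) hc0'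
  -- Clearing denominators, `(q₂ x, q₁ y)` lies in the lattice of `h` itself; this costs the factor
  -- `q₁ + q₂`.
  have hlat : ∀ x y : ℤ, (y : ZMod p) = c * x → 0 < x → y ≠ 0 →
      P / (q₁ + q₂) ≤ max (x : ℝ) |(y : ℝ)| := by
    intro x y hxy hx _
    have hXY : ((q₁ * y : ℤ) : ZMod p) = (h : ZMod p) * ((q₂ * x : ℤ) : ZMod p) := by
      push_cast at hb0 ⊢
      rw [hxy, hcdef]
      push_cast
      field_simp
    have h1 := le_abs_add_abs_pow_totient hk hz (X := q₂ * x) (Y := q₁ * y)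
      (by positivity) hXY
    have h2 : P ≤ |((q₂ * x : ℤ) : ℝ)| + |((q₁ * y : ℤ) : ℝ)| := by
      rw [hP, one_div, Real.rpow_inv_le_iff_of_pos (by positivity) (by positivity) (by linarith),
        Real.rpow_natCast]
      exact h1
    have hxR : (0 : ℝ) < x := by exact_mod_cast hx
    push_cast at h2
    rw [abs_mul, abs_mul, Nat.abs_cast, Nat.abs_cast, abs_of_pos hxR] at h2
    rw [div_le_iff₀ hQ]
    calc P ≤ q₂ * x + q₁ * |(y : ℝ)| := h2
      _ ≤ q₂ * max (x : ℝ) |(y : ℝ)| + q₁ * max (x : ℝ) |(y : ℝ)| := by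
        gcongr
        · exact le_max_left _ _
        · exact le_max_right _ _
      _ = max (x : ℝ) |(y : ℝ)| * (q₁ + q₂) := by ring
  have hv0 : 0 < c.val := by
    rw [Nat.pos_iff_ne_zero, Ne, ZMod.val_eq_zero]; exact hc0
  have hvlt : c.val < p := c.val_lt
  -- Initial cofactors `q = 1`, `q' = 0`: the invariant reads `1 · p + 0 · c = p`.
  have hmain := abs_natDedekindSum_le (p := p) (c := c) (div_pos hPpos hQ) hlat c.val p 1 0 1 hv0
    hvlt.le one_pos (Nat.coprime_of_lt_prime hv0.ne' hvlt hp).symm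
    (Or.inl rfl) (by simp) (by simp) (by simp)
  rw [dedekindRademacherSum_eq_natDedekindSum hb0 hc0']
  refine hmain.trans ?_
  have hlogp : 1 ≤ Real.log p := by
    rw [Real.le_log_iff_exp_le (by linarith)]
    have := Real.exp_one_lt_d9
    linarith
  -- As `log 2 > 1/2`, the left side is at most `1 + 4 log p`, and `log p ≥ 1` gives the 5.
  have hlogb : 1 + Real.logb 2 ((c.val : ℝ) * p) ≤ 5 * Real.log p ^ 2 := by
    have hvR : (0 : ℝ) < c.val := by exact_mod_cast hv0
    have h1 : Real.log ((c.val : ℝ) * p) ≤ 2 * Real.log p := by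
      rw [Real.log_mul (by positivity) (by positivity)]
      have := Real.log_le_log hvR (show (c.val : ℝ) ≤ p by exact_mod_cast hvlt.le)
      linarith
    have hl2 := Real.log_two_gt_d9
    have h2 : Real.logb 2 ((c.val : ℝ) * p) ≤ 4 * Real.log p := by
      rw [Real.logb, div_le_iff₀ (by linarith)]
      nlinarith
    nlinarith
  set R : ℝ := (p : ℝ) ^ (1 - 1 / (k.totient : ℝ)) with hR
  have hR1 : 1 ≤ R := Real.one_le_rpow (by linarith) (by linarith)
  have hquot : (p : ℝ) / (P / (q₁ + q₂)) = (q₁ + q₂) * R := by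
    rw [hR, Real.rpow_sub (by linarith), Real.rpow_one, ← hP]
    field_simp
  rw [hquot]
  have hQR : 0 ≤ ((q₁ : ℝ) + q₂) * R := by positivity
  calc (1 + ((q₁ : ℝ) + q₂) * R) * (1 + Real.logb 2 ((c.val : ℝ) * p))
      ≤ (1 + ((q₁ : ℝ) + q₂) * R) * (5 * Real.log p ^ 2) := by gcongr
    _ ≤ (R + (q₁ + q₂) * R) * (5 * Real.log p ^ 2) := by gcongr
    _ = 5 * (1 + (q₁ + q₂)) * Real.log p ^ 2 * R := by ring

theorem mainTheorem2 :
    (∃ C : ℝ, 0 < C ∧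
      ∀ (p k : ℕ) (h : ℤ) (u : (ZMod p)ˣ),
        p.Prime → (u : ZMod p) = (h : ZMod p) → orderOf u = k → Odd k → 3 ≤ k →
          |dedekindSum h p| ≤
            C * (Real.log (p : ℝ)) ^ 2 * (p : ℝ) ^ (1 - 1 / (Nat.totient k : ℝ))) ∧
    (∀ q₁ q₂ : ℕ, ∃ C : ℝ, 0 < C ∧
      ∀ (p k : ℕ) (h : ℤ) (u : (ZMod p)ˣ),
        p.Prime → Nat.Coprime q₁ p → Nat.Coprime q₂ p →
        (u : ZMod p) = (h : ZMod p) → orderOf u = k → 3 ≤ k →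
          |dedekindRademacherSum (q₁ : ℤ) ((q₂ : ℤ) * h) p| ≤
            C * (Real.log (p : ℝ)) ^ 2 * (p : ℝ) ^ (1 - 1 / (Nat.totient k : ℝ))) := by

  refine ⟨⟨5 * (1 + (1 + 1)), by norm_num, ?_⟩,
    fun q₁ q₂ => ⟨5 * (1 + (q₁ + q₂)), by positivity, ?_⟩⟩
  · intro p k h u hp hu hord _ hk
    rw [dedekindSum_eq_dedekindRademacherSum]
    simpa using abs_dedekindRademacherSum_le 1 1 p k h u hp (Nat.coprime_one_left p)
      (Nat.coprime_one_left p) hu hord hk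
  · intro p k h u hp hq₁ hq₂ hu hord hk
    exact abs_dedekindRademacherSum_le q₁ q₂ p k h u hp hq₁ hq₂ hu hord hk
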